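/- Let $M,N\ge 1$ be integers, $\sigma>0$, $P>0$, $\eta_0>0$, $|\rho|<1$ and $\gamma_{th}>0$. Consider a base station with $N$ antennas and a receiver with a fluid antenna with $M$ ports, under equally correlated Rayleigh fading: for $1\le n\le N$ and $2\le m\le M$, $$h_{1n}=\sigma x_{0n}+j\sigma y_{0n},\qquad h_{mn}=\sigma\big(\sqrt{1-\rho^2}\,x_{mn}+\rho x_{0n}\big)+j\sigma\big(\sqrt{1-\rho^2}\,y_{mn}+\rho y_{0n}\big),$$ where all $x_{0n},y_{0n},x_{mn},y_{mn}$ are mutually independent real Gaussian random variables with mean $0$ and variance $1/2$. Let $X_m=\sum_{n=1}^N|h_{mn}|^2$ be the precoding gain of port $m$ and $X_{\rm FAS}=\max_{1\le m\le M}X_m$. With maximum-ratio transmission $\mathbf w_m=\mathbf h_m^H/\|\mathbf h_m\|$, transmit power $P$ and noise power $\eta_0^2$, let $\gamma_m=P|\mathbf w_m\mathbf h_m|^2/\eta_0^2=PX_m/\eta_0^2$ be the received SNR of port $m$, $\gamma_{\rm FAS}=\max_m\gamma_m$, and $\bar\gamma=P\sigma^2/\eta_0^2$ the average single-branch SNR.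 Let $\gamma(N,z)=\int_0^z t^{N-1}e^{-t}\,dt$, let $Q_N$ be the generalized Marcum Q-function $$Q_N(a,b)=\frac1{a^{N-1}}\int_b^\infty x^N e^{-(x^2+a^2)/2}I_{N-1}(ax)\,dx\quad(a>0,\ b\ge0),\qquad Q_N(0,b)=\lim_{a\to0^+}Q_N(a,b),$$ with $I_{N-1}$ the modified Bessel function of the first kind, and for $s>0$ put $$L_s(\gamma_{th})=\frac{1}{(N-1)!}\,\gamma\!\left(N,\frac{\gamma_{th}}{s}\right)\left(1-Q_N\!\left(\sqrt{\frac{2\rho^2\gamma_{th}}{s(1-\rho^2)}},\sqrt{\frac{2\gamma_{th}}{s(1-\rho^2)}}\right)\right)^{M-1}.$$ Then the outage probability satisfies $$\Pr(X_{\rm FAS}<\gamma_{th})\ \ge\ L_{\sigma^2}(\gamma_{th}),$$ and, when the outage event is expressed through the received SNR instead of the precoding gain, $$\Pr(\gamma_{\rm FAS}<\gamma_{th})\ \ge\ L_{\bar\gamma}(\gamma_{th}),\qquad \Pr(\gamma_{\rm FAS}/\bar\gamma<\gamma_{th})\ \ge\ L_{1}(\gamma_{th}).$$ -/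

import Mathlib

open MeasureTheory ProbabilityTheory

namespace FAS

/-! ### Special functions -/

/-- The modified Bessel function of the first kind `I_n` of integer order `n ≥ 0`. -/
noncomputable def besselI (n : ℕ) (x : ℝ) : ℝ :=
  ∑' k : ℕ, (x / 2) ^ (2 * k + n) / ((k.factorial : ℝ) * ((k + n).factorial : ℝ))

/-- The generalized Marcum Q-function `Q_N(a, b)` of integer order `N ≥ 1`, for `a, b ≥ 0`:
`Q_N(a, b) = a^{-(N-1)} ∫_b^∞ x^N exp(-(x² + a²) / 2) I_{N-1}(a x) dx` for `a > 0`, and its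
limit as `a → 0` at `a = 0`. -/
noncomputable def marcumQ (N : ℕ) (a b : ℝ) : ℝ :=
  if a = 0 then
    (∫ x in Set.Ioi b, x ^ (2 * N - 1) * Real.exp (-(x ^ 2) / 2))
      / (2 ^ (N - 1) * ((N - 1).factorial : ℝ))
  else
    (∫ x in Set.Ioi b, x ^ N * Real.exp (-(x ^ 2 + a ^ 2) / 2) * besselI (N - 1) (a * x))
      / a ^ (N - 1)

/-- The lower incomplete gamma function `γ(N, z) = ∫_0^z t^{N-1} e^{-t} dt` for an integer
`N ≥ 1` and real `z ≥ 0`. -/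
noncomputable def lowerGamma (N : ℕ) (z : ℝ) : ℝ :=
  ∫ t in (0 : ℝ)..z, t ^ (N - 1) * Real.exp (-t)

/-- The closed-form lower bound on the outage probability at threshold `g`, for `N` antennas,
`M` ports, correlation parameter `ρ`, where `s` is the average single-branch value of the
quantity which is compared with the threshold. -/
noncomputable def outageLowerBound (N M : ℕ) (ρ s g : ℝ) : ℝ :=
  1 / ((N - 1).factorial : ℝ) * lowerGamma N (g / s) *
    (1 - marcumQ N (√(2 * ρ ^ 2 * g / (s * (1 - ρ ^ 2)))) (√(2 * g / (s * (1 - ρ ^ 2)))))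
      ^ (M - 1)

/-! ### The channel model

Port number `m ∈ {1, …, M}` is represented by `m - 1 : Fin M`, so that `0 : Fin M` is the first
port. The variables `x 0 n`, `y 0 n` are the common components `x_{0n}`, `y_{0n}`, and for `m ≠ 0`
the variables `x m n`, `y m n` are the components that are specific to the port `m`. -/

section Channel

variable {Ω : Type*} {M N : ℕ} [NeZero M]

/-- The driving variables `x_{mn}`, `y_{mn}` are mutually independent real Gaussian random
variables with mean zero and variance `1 / 2`. -/
structure IsDrivingNoise [MeasurableSpace Ω] (μ : Measure Ω)
    (x y : Fin M → Fin N → Ω → ℝ) : Prop where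
  law_x : ∀ m n, HasLaw (x m n) (gaussianReal 0 (1 / 2)) μ
  law_y : ∀ m n, HasLaw (y m n) (gaussianReal 0 (1 / 2)) μ
  indep : iIndepFun
    (Sum.elim (fun p : Fin M × Fin N => x p.1 p.2) (fun p : Fin M × Fin N => y p.1 p.2)) μ

/-- The equally correlated channel coefficients `h_{mn}`. -/
noncomputable def channel (σ ρ : ℝ) (x y : Fin M → Fin N → Ω → ℝ) (m : Fin M) (n : Fin N)
    (ω : Ω) : ℂ :=
  if m = 0 then
    ((σ * x 0 n ω : ℝ) : ℂ) + Complex.I * ((σ * y 0 n ω : ℝ) : ℂ)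
  else
    ((σ * (√(1 - ρ ^ 2) * x m n ω + ρ * x 0 n ω) : ℝ) : ℂ)
      + Complex.I * ((σ * (√(1 - ρ ^ 2) * y m n ω + ρ * y 0 n ω) : ℝ) : ℂ)

/-- The precoding gain `X_m = ∑_n |h_{mn}|²` of port `m`. -/
noncomputable def gain (σ ρ : ℝ) (x y : Fin M → Fin N → Ω → ℝ) (m : Fin M) (ω : Ω) : ℝ :=
  ∑ n, ‖channel σ ρ x y m n ω‖ ^ 2

/-- The precoding gain `X_FAS = max_m X_m` of the activated port. -/
noncomputable def gainFAS (σ ρ : ℝ) (x y : Fin M → Fin N → Ω → ℝ) (ω : Ω) : ℝ :=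
  Finset.univ.sup' Finset.univ_nonempty fun m => gain σ ρ x y m ω

/-- The maximum-ratio transmission precoding vector `w_m = h_mᴴ / ‖h_m‖` of port `m`. -/
noncomputable def precoder (σ ρ : ℝ) (x y : Fin M → Fin N → Ω → ℝ) (m : Fin M) (ω : Ω)
    (n : Fin N) : ℂ :=
  star (channel σ ρ x y m n ω) / ((√(∑ k, ‖channel σ ρ x y m k ω‖ ^ 2) : ℝ) : ℂ)

/-- The received SNR `γ_m = P |w_m h_m|² / η₀²` at port `m`, for the transmit power `P` and the
noise power `η₀²`. -/
noncomputable def snr (P η₀ σ ρ : ℝ) (x y : Fin M → Fin N → Ω → ℝ) (m : Fin M) (ω : Ω) : ℝ :=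
  P * ‖∑ n, precoder σ ρ x y m ω n * channel σ ρ x y m n ω‖ ^ 2 / η₀ ^ 2

/-- The received SNR `γ_FAS = max_m γ_m` of the system. -/
noncomputable def snrFAS (P η₀ σ ρ : ℝ) (x y : Fin M → Fin N → Ω → ℝ) (ω : Ω) : ℝ :=
  Finset.univ.sup' Finset.univ_nonempty fun m => snr P η₀ σ ρ x y m ω

end Channel

/-- The average single-branch SNR `P σ² / η₀²`, where `σ² = 𝔼|h_{mn}|²`. -/
noncomputable def avgSNR (P η₀ σ : ℝ) : ℝ := P * σ ^ 2 / η₀ ^ 2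

end FAS

namespace FAS

open Filter Topology
open scoped NNReal ENNReal Nat

/-! After scaling, every outage event says that all normalized gains lie below one threshold `t`.
Condition on the common vector `a` of port `0`: the other ports become independent, and each gain
divided by `1 - ρ ^ 2` is the squared norm of a shifted Gaussian vector, with law `noncentralGamma n
r` for `r = ρ ^ 2 * ‖a‖ ^ 2 / (1 - ρ ^ 2)`. Its distribution function decreases in `r`. On the event
`‖a‖ ^ 2 < t`, which outage requires, `r` may therefore be replaced by its value at `‖a‖ ^ 2 = t`,
which bounds the conditional probability below by a constant. Integrating over that event gives the
Erlang probability times the `(M - 1)`-th power of the constant (`le_measure_normalizedGain_lt`).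

Writing the noncentral law as a Poisson mixture of Erlang laws gives the monotonicity
(`measureReal_noncentralGamma_Iio_antitone`), the characteristic function that identifies it with
the Gaussian law (`map_sum_sq_add_gaussianReal`), and a termwise match with the Bessel series in the
Marcum function (`one_sub_marcumQ`). -/

/-! ### Erlang distributions. -/

/-- The density of the Erlang distribution with shape `k + 1` and rate one. -/
noncomputable def erlangDensity (k : ℕ) (t : ℝ) : ℝ := t ^ k * Real.exp (-t) / k !

/-- The Erlang distribution with shape `k + 1` and rate one. -/
noncomputable def erlang (k : ℕ) : Measure ℝ :=
  (volume.restrict (Set.Ioi 0)).withDensity fun t => ENNReal.ofReal (erlangDensity k t)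

lemma erlangDensity_nonneg (k : ℕ) {t : ℝ} (ht : 0 ≤ t) : 0 ≤ erlangDensity k t := by
  unfold erlangDensity; positivity

@[fun_prop]
lemma continuous_erlangDensity (k : ℕ) : Continuous (erlangDensity k) := by
  unfold erlangDensity; fun_prop

lemma integral_pow_mul_exp_neg (k : ℕ) : ∫ t in Set.Ioi (0 : ℝ), t ^ k * Real.exp (-t) = k ! := by
  rw [← Real.Gamma_nat_eq_factorial, Real.Gamma_eq_integral (by positivity)]
  refine setIntegral_congr_fun measurableSet_Ioi fun t ht => ?_
  simp [mul_comm]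

lemma integrableOn_pow_mul_exp_neg (k : ℕ) :
    IntegrableOn (fun t : ℝ => t ^ k * Real.exp (-t)) (Set.Ioi 0) := by
  refine Integrable.of_integral_ne_zero ?_
  rw [integral_pow_mul_exp_neg]
  positivity

lemma integrableOn_erlangDensity (k : ℕ) : IntegrableOn (erlangDensity k) (Set.Ioi 0) :=
  (integrableOn_pow_mul_exp_neg k).div_const _

lemma integral_erlang {E : Type*} [NormedAddCommGroup E] [NormedSpace ℝ E] (k : ℕ) (f : ℝ → E) :
    ∫ t, f t ∂erlang k = ∫ t in Set.Ioi 0, erlangDensity k t • f t := by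
  rw [erlang, integral_withDensity_eq_integral_toReal_smul (by fun_prop) (by simp)]
  refine setIntegral_congr_fun measurableSet_Ioi fun t ht => ?_
  rw [ENNReal.toReal_ofReal (erlangDensity_nonneg k (le_of_lt ht))]

instance isProbabilityMeasure_erlang (k : ℕ) : IsProbabilityMeasure (erlang k) := by
  constructor
  rw [erlang, withDensity_apply _ MeasurableSet.univ, Measure.restrict_univ,
    ← ofReal_integral_eq_lintegral_ofReal (integrableOn_erlangDensity k)]
  · simp only [erlangDensity]
    rw [integral_div, integral_pow_mul_exp_neg, div_self (by positivity), ENNReal.ofReal_one]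
  · exact (ae_restrict_iff' measurableSet_Ioi).2
      (ae_of_all _ fun t ht => erlangDensity_nonneg k (le_of_lt ht))

lemma measureReal_erlang (k : ℕ) {s : Set ℝ} (hs : MeasurableSet s) :
    (erlang k).real s = ∫ t in s ∩ Set.Ioi 0, erlangDensity k t := by
  rw [← integral_indicator_one hs, integral_erlang, Set.inter_comm, ← setIntegral_indicator hs]
  refine setIntegral_congr_fun measurableSet_Ioi fun t _ => ?_
  by_cases h : t ∈ s <;> simp [h]

lemma measureReal_erlang_Iio (k : ℕ) {y : ℝ} (hy : 0 ≤ y) :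
    (erlang k).real (Set.Iio y) = ∫ t in 0..y, erlangDensity k t := by
  rw [measureReal_erlang k measurableSet_Iio, Set.Iio_inter_Ioi, intervalIntegral.integral_of_le hy,
    integral_Ioc_eq_integral_Ioo]

lemma measureReal_erlang_Iio_eq_lowerGamma (k : ℕ) {y : ℝ} (hy : 0 ≤ y) :
    (erlang k).real (Set.Iio y) = 1 / (k ! : ℝ) * lowerGamma (k + 1) y := by
  rw [measureReal_erlang_Iio k hy, lowerGamma, ← intervalIntegral.integral_const_mul]
  refine intervalIntegral.integral_congr fun t _ => ?_
  simp only [erlangDensity, Nat.add_sub_cancel]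
  ring

lemma measureReal_erlang_Ioi (k : ℕ) {y : ℝ} (hy : 0 ≤ y) :
    (erlang k).real (Set.Ioi y) = ∫ t in Set.Ioi y, erlangDensity k t := by
  rw [measureReal_erlang k measurableSet_Ioi,
    Set.inter_eq_left.2 (Set.Ioi_subset_Ioi hy)]

/-- There are no atoms, so strict and weak inequalities agree; this links the strict outage event to
the upper tails in the Marcum function. -/
lemma measureReal_erlang_Iio_eq_one_sub (k : ℕ) (y : ℝ) :
    (erlang k).real (Set.Iio y) = 1 - (erlang k).real (Set.Ioi y) := by
  have hac : erlang k ≪ volume :=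
    (withDensity_absolutelyContinuous _ _).trans Measure.restrict_le_self.absolutelyContinuous
  rw [← probReal_compl_eq_one_sub measurableSet_Ioi, Set.compl_Ioi]
  exact measureReal_congr (hac.ae_eq Iio_ae_eq_Iic)

/-- The derivative of the density of index `k + 1` is the density of index `k` minus that of index
`k + 1`. Hence for `y > 0` the drop in the distribution function is `erlangDensity (k + 1) y`, which
is nonnegative. -/
lemma measureReal_erlang_Iio_antitone (y : ℝ) :
    Antitone fun k => (erlang k).real (Set.Iio y) := by
  refine antitone_nat_of_succ_le fun k => ?_
  rcases le_or_gt y 0 with hy | hy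
  · have h : ∀ j, (erlang j).real (Set.Iio y) = 0 := fun j => by
      rw [measureReal_erlang j measurableSet_Iio, Set.Iio_inter_Ioi, Set.Ioo_eq_empty (by simpa),
        Measure.restrict_empty, integral_zero_measure]
    simp [h]
  · have hint : ∀ j, IntervalIntegrable (erlangDensity j) volume 0 y := fun j =>
      (continuous_erlangDensity j).intervalIntegrable _ _
    rw [measureReal_erlang_Iio _ hy.le, measureReal_erlang_Iio _ hy.le, ← sub_nonneg,
      ← intervalIntegral.integral_sub (hint _) (hint _),
      intervalIntegral.integral_eq_sub_of_hasDerivAt (f := erlangDensity (k + 1)) ?_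
        ((hint _).sub (hint _))]
    · have h0 : erlangDensity (k + 1) 0 = 0 := by simp [erlangDensity]
      rw [h0, sub_zero]
      exact erlangDensity_nonneg _ hy.le
    · intro t _
      have h := ((hasDerivAt_pow (k + 1) t).mul (hasDerivAt_neg t).exp).div_const ((k + 1)! : ℝ)
      convert! h using 1
      simp only [erlangDensity, Nat.factorial_succ]
      push_cast
      field_simp
      ring

/-- Integrating the derivative of `t ^ (k + 1) * exp (-(z * t))` over the half-line yields the
recursion `z * I (k + 1) = (k + 1) * I k`. Complex `z` is needed for characteristic functions, where
`z = 1 - ξ * I`. -/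
lemma integral_pow_mul_cexp_neg_mul (k : ℕ) {z : ℂ} (hz : 0 < z.re) :
    IntegrableOn (fun t : ℝ => (t : ℂ) ^ k * Complex.exp (-(z * t))) (Set.Ioi 0) ∧
      ∫ t in Set.Ioi (0 : ℝ), (t : ℂ) ^ k * Complex.exp (-(z * t)) = k ! / z ^ (k + 1) := by
  have hz0 : z ≠ 0 := by rintro rfl; simp at hz
  have hint : ∀ k : ℕ, IntegrableOn (fun t : ℝ => (t : ℂ) ^ k * Complex.exp (-(z * t)))
      (Set.Ioi 0) := fun k => by
    have h := integrableOn_rpow_mul_exp_neg_mul_rpow (s := k) (p := 1) (b := z.re)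
      (by linarith [k.cast_nonneg (α := ℝ)]) one_pos hz
    refine Integrable.mono' h (by fun_prop) ?_
    refine (ae_restrict_iff' measurableSet_Ioi).2 (ae_of_all _ fun t ht => ?_)
    have ht : 0 < t := ht
    simp [Complex.norm_exp, abs_of_pos ht]
  have htend : ∀ k : ℕ, Tendsto (fun t : ℝ => (t : ℂ) ^ k * Complex.exp (-(z * t))) atTop (𝓝 0) :=
    fun k => by
    rw [tendsto_zero_iff_norm_tendsto_zero]
    have h := tendsto_rpow_mul_exp_neg_mul_atTop_nhds_zero k z.re hz
    refine h.congr' ?_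
    filter_upwards [eventually_gt_atTop 0] with t ht
    simp [Complex.norm_exp, abs_of_pos ht]
  refine ⟨hint k, ?_⟩
  have hexp : ∀ t : ℝ, HasDerivAt (fun t : ℝ => Complex.exp (-(z * t)))
      (Complex.exp (-(z * t)) * -z) t := fun t => by
    have h := ((Complex.ofRealCLM.hasDerivAt (x := t)).const_mul z).neg.cexp
    simpa using h
  induction k with
  | zero =>
    have h := integral_Ioi_of_hasDerivAt_of_tendsto' (a := 0)
      (f := fun t : ℝ => Complex.exp (-(z * t)) * -z⁻¹)
      (f' := fun t : ℝ => (t : ℂ) ^ 0 * Complex.exp (-(z * t))) (m := 0)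
      (fun t _ => by
        convert! (hexp t).mul_const (-z⁻¹) using 1
        field_simp) (hint 0) (by simpa using (htend 0).mul_const (-z⁻¹))
    rw [h]; simp
  | succ k ih =>
    have hd : ∀ t : ℝ, HasDerivAt (fun t : ℝ => (t : ℂ) ^ (k + 1) * Complex.exp (-(z * t)))
        ((k + 1 : ℂ) * ((t : ℂ) ^ k * Complex.exp (-(z * t)))
          - z * ((t : ℂ) ^ (k + 1) * Complex.exp (-(z * t)))) t := fun t => by
      have h := ((Complex.ofRealCLM.hasDerivAt (x := t)).pow (k + 1)).mul (hexp t)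
      convert! h using 1
      simp
      ring
    have h := integral_Ioi_of_hasDerivAt_of_tendsto' (a := 0) (fun t _ => hd t)
      (((hint k).const_mul _).sub ((hint (k + 1)).const_mul _)) (htend (k + 1))
    rw [integral_sub ((hint k).const_mul _) ((hint (k + 1)).const_mul _), integral_const_mul,
      integral_const_mul, ih] at h
    have h' : z * ∫ t in Set.Ioi (0 : ℝ), (t : ℂ) ^ (k + 1) * Complex.exp (-(z * t))
        = (k + 1) * (k ! / z ^ (k + 1)) := by
      have : (0 : ℂ) - ((0 : ℝ) : ℂ) ^ (k + 1) * Complex.exp (-(z * ((0 : ℝ) : ℂ))) = 0 := by simp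
      rw [this] at h
      linear_combination -h
    rw [← mul_right_inj' hz0, h', Nat.factorial_succ]
    push_cast
    field_simp
    ring

lemma charFun_erlang (k : ℕ) (ξ : ℝ) :
    charFun (erlang k) ξ = ((1 - ξ * Complex.I) ^ (k + 1))⁻¹ := by
  rw [charFun_apply_real, integral_erlang]
  have h := (integral_pow_mul_cexp_neg_mul k (z := 1 - ξ * Complex.I) (by simp)).2
  have hk : (k ! : ℂ) ≠ 0 := Nat.cast_ne_zero.2 k.factorial_ne_zero
  have h' : ∀ t : ℝ, erlangDensity k t • Complex.exp (ξ * t * Complex.I)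
      = ((t : ℂ) ^ k * Complex.exp (-((1 - ξ * Complex.I) * t))) / k ! := fun t => by
    simp only [erlangDensity, Complex.real_smul]
    push_cast
    rw [show -((1 - ξ * Complex.I) * t) = -(t : ℂ) + ξ * t * Complex.I by ring, Complex.exp_add]
    ring
  simp_rw [h']
  rw [integral_div, h]
  field_simp

/-! ### Poisson mixtures of Erlang distributions. -/

/-- The family of Erlang distributions with shapes `n + 1 + k` as a kernel in `k`. -/
noncomputable def erlangKernel (n : ℕ) : Kernel ℕ ℝ :=
  Kernel.ofFunOfCountable fun k => erlang (n + k)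

instance isMarkovKernel_erlangKernel (n : ℕ) : IsMarkovKernel (erlangKernel n) :=
  ⟨fun k => isProbabilityMeasure_erlang (n + k)⟩

/-- The law of half a noncentral chi-squared variable with `2 (n + 1)` degrees of freedom and
noncentrality parameter `2 r`: a Poisson mixture of Erlang distributions. -/
noncomputable def noncentralGamma (n : ℕ) (r : ℝ≥0) : Measure ℝ :=
  erlangKernel n ∘ₘ poissonMeasure r

instance isProbabilityMeasure_noncentralGamma (n : ℕ) (r : ℝ≥0) :
    IsProbabilityMeasure (noncentralGamma n r) := by
  unfold noncentralGamma; infer_instance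

lemma integral_noncentralGamma {E : Type*} [NormedAddCommGroup E] [NormedSpace ℝ E]
    (n : ℕ) (r : ℝ≥0) {f : ℝ → E} (hf : Integrable f (noncentralGamma n r)) :
    ∫ t, f t ∂noncentralGamma n r = ∫ k, ∫ t, f t ∂erlang (n + k) ∂poissonMeasure r := by
  have h : noncentralGamma n r = (erlangKernel n ∘ₖ Kernel.const Unit (poissonMeasure r)) () := by
    rw [Kernel.comp_apply, Kernel.const_apply]; rfl
  rw [h] at hf ⊢
  rw [Kernel.integral_comp hf, Kernel.const_apply]
  rfl

lemma measureReal_noncentralGamma (n : ℕ) (r : ℝ≥0) {s : Set ℝ} (hs : MeasurableSet s) :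
    (noncentralGamma n r).real s = ∫ k, (erlang (n + k)).real s ∂poissonMeasure r := by
  rw [← integral_indicator_one hs, integral_noncentralGamma]
  · simp_rw [integral_indicator_one hs]
  · exact (integrable_const (1 : ℝ)).indicator hs

lemma integrable_measureReal_erlang (n : ℕ) (r : ℝ≥0) (s : Set ℝ) :
    Integrable (fun k => (erlang (n + k)).real s) (poissonMeasure r) :=
  Integrable.of_bound (C := 1) (by fun_prop) (ae_of_all _ fun k => by
    rw [Real.norm_of_nonneg measureReal_nonneg]; exact measureReal_le_one)

lemma measureReal_noncentralGamma_zero_Iio (n : ℕ) (y : ℝ) :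
    (noncentralGamma n 0).real (Set.Iio y) = (erlang n).real (Set.Iio y) := by
  rw [measureReal_noncentralGamma n 0 measurableSet_Iio, integral_poissonMeasure,
    tsum_eq_single 0 (fun k hk => by simp [hk])]
  simp

/-- A Poisson variable of mean `r + d` is one of mean `r` plus an independent one of mean `d`; the
extra summand only raises the Erlang shape, which lowers the distribution function. -/
lemma measureReal_noncentralGamma_Iio_antitone (n : ℕ) (y : ℝ) :
    Antitone fun r => (noncentralGamma n r).real (Set.Iio y) := by
  intro r r' hr
  obtain ⟨d, rfl⟩ := exists_add_of_le hr
  simp only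
  rw [measureReal_noncentralGamma n _ measurableSet_Iio,
    measureReal_noncentralGamma n _ measurableSet_Iio, ← poissonMeasure_conv_poissonMeasure,
    integral_conv]
  · refine integral_mono ?_ (integrable_measureReal_erlang n r _) fun k => ?_
    · refine Integrable.of_bound (C := 1) Measurable.of_discrete.aestronglyMeasurable
        (ae_of_all _ fun k => ?_)
      rw [Real.norm_of_nonneg (integral_nonneg fun _ => measureReal_nonneg)]
      calc ∫ j, (erlang (n + (k + j))).real (Set.Iio y) ∂poissonMeasure d
          ≤ ∫ _, 1 ∂poissonMeasure d := by
            refine integral_mono ?_ (integrable_const _) fun j => measureReal_le_one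
            simpa [add_assoc] using integrable_measureReal_erlang (n + k) d (Set.Iio y)
        _ = 1 := by simp
    · calc ∫ j, (erlang (n + (k + j))).real (Set.Iio y) ∂poissonMeasure d
          ≤ ∫ _, (erlang (n + k)).real (Set.Iio y) ∂poissonMeasure d := by
            refine integral_mono ?_ (integrable_const _) fun j =>
              measureReal_erlang_Iio_antitone y (by simp)
            simpa [add_assoc] using integrable_measureReal_erlang (n + k) d (Set.Iio y)
        _ = (erlang (n + k)).real (Set.Iio y) := by simp
  · rw [poissonMeasure_conv_poissonMeasure]
    exact integrable_measureReal_erlang n _ _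

/-- With `z = 1 - ξ * I`, the mixture turns into the exponential series in `r / z`, and the
exponents combine as `r / z - r = ξ * I * r / z`. -/
lemma charFun_noncentralGamma (n : ℕ) (r : ℝ≥0) (ξ : ℝ) :
    charFun (noncentralGamma n r) ξ = ((1 - ξ * Complex.I) ^ (n + 1))⁻¹ *
      Complex.exp (ξ * Complex.I * r / (1 - ξ * Complex.I)) := by
  set z : ℂ := 1 - ξ * Complex.I with hz
  have hz0 : z ≠ 0 := by
    intro h
    have := congrArg Complex.re h
    simp [hz] at this
  have hint : Integrable (fun t : ℝ => Complex.exp (ξ * t * Complex.I)) (noncentralGamma n r) :=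
    Integrable.of_bound (C := 1) (by fun_prop) (ae_of_all _ fun t => by
      rw [← Complex.ofReal_mul, Complex.norm_exp_ofReal_mul_I])
  rw [charFun_apply_real, integral_noncentralGamma n r hint]
  simp_rw [← charFun_apply_real, charFun_erlang, ← hz]
  rw [integral_poissonMeasure]
  calc ∑' k, (Real.exp (-r) * r ^ k / k ! : ℝ) • (z ^ (n + k + 1))⁻¹
      = ∑' k, ((z ^ (n + 1))⁻¹ * Complex.exp (-r)) * ((r / z) ^ k / k !) := by
        congr with k
        rw [Complex.real_smul]
        push_cast
        rw [div_pow, show n + k + 1 = (n + 1) + k by ring, pow_add]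
        field_simp
    _ = (z ^ (n + 1))⁻¹ * Complex.exp (-r) * Complex.exp (r / z) := by
        rw [tsum_mul_left, (NormedSpace.expSeries_div_hasSum_exp (r / z : ℂ)).tsum_eq,
          Complex.exp_eq_exp_ℂ]
    _ = _ := by
        rw [mul_assoc, ← Complex.exp_add]
        congr 2
        field_simp
        rw [hz]
        ring

/-! ### Squared norms of shifted Gaussian vectors. -/

lemma integral_cexp_sq_add_gaussianReal (ξ v : ℝ) :
    ∫ u, Complex.exp (ξ * ((u + v) ^ 2 : ℝ) * Complex.I) ∂gaussianReal 0 (1 / 2) =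
      ((Real.pi / (1 - ξ * Complex.I)) ^ (1 / 2 : ℂ) * (√Real.pi : ℂ)⁻¹) *
        Complex.exp (ξ * Complex.I * (v ^ 2 : ℝ) / (1 - ξ * Complex.I)) := by
  have hz0 : 1 - ξ * Complex.I ≠ 0 := by
    intro h
    have := congrArg Complex.re h
    simp at this
  rw [integral_gaussianReal_eq_integral_smul (by norm_num)]
  have h : ∀ u : ℝ, gaussianPDFReal 0 (1 / 2) u • Complex.exp (ξ * ((u + v) ^ 2 : ℝ) * Complex.I)
      = (√Real.pi : ℂ)⁻¹ * Complex.exp (-(1 - ξ * Complex.I) * u ^ 2 + (2 * ξ * v * Complex.I) * u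
        + ξ * v ^ 2 * Complex.I) := fun u => by
    rw [gaussianPDFReal, Complex.real_smul]
    have h1 : √(2 * Real.pi * ((1 / 2 : ℝ≥0) : ℝ)) = √Real.pi := by
      congr 1; push_cast; ring
    have h2 : -(u - 0) ^ 2 / (2 * ((1 / 2 : ℝ≥0) : ℝ)) = -u ^ 2 := by push_cast; ring
    rw [h1, h2]
    push_cast
    rw [mul_assoc, ← Complex.exp_add]
    congr 2
    ring
  simp_rw [h]
  rw [integral_const_mul, integral_cexp_quadratic (by simp)]
  have hexp : (ξ * v ^ 2 * Complex.I - (2 * ξ * v * Complex.I) ^ 2 /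
      (4 * -(1 - ξ * Complex.I)) : ℂ) =
      ξ * Complex.I * (v ^ 2 : ℝ) / (1 - ξ * Complex.I) := by
    push_cast
    field_simp
    ring
  rw [hexp, neg_neg]
  ring

/-- The squared norm of a shifted vector of `2 (n + 1)` independent centered Gaussian variables of
variance `1 / 2`. -/
lemma map_sum_sq_add_gaussianReal {κ : Type*} [Fintype κ] {n : ℕ}
    (hκ : Fintype.card κ = 2 * (n + 1)) (v : κ → ℝ) (r : ℝ≥0) (hr : (r : ℝ) = ∑ i, v i ^ 2) :
    (Measure.pi fun _ : κ => gaussianReal 0 (1 / 2)).map (fun u => ∑ i, (u i + v i) ^ 2) =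
      noncentralGamma n r := by
  have hm : Measurable fun u : κ → ℝ => ∑ i, (u i + v i) ^ 2 := by fun_prop
  have : IsProbabilityMeasure ((Measure.pi fun _ : κ => gaussianReal 0 (1 / 2)).map
      (fun u => ∑ i, (u i + v i) ^ 2)) := Measure.isProbabilityMeasure_map hm.aemeasurable
  apply Measure.ext_of_charFun
  ext ξ
  rw [charFun_noncentralGamma, charFun_apply_real,
    integral_map hm.aemeasurable (by fun_prop)]
  have h : ∀ u : κ → ℝ, Complex.exp (ξ * ((∑ i, (u i + v i) ^ 2 : ℝ) : ℂ) * Complex.I)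
      = ∏ i, Complex.exp (ξ * ((u i + v i) ^ 2 : ℝ) * Complex.I) := fun u => by
    rw [← Complex.exp_sum, Complex.ofReal_sum, Finset.mul_sum, Finset.sum_mul]
  simp_rw [h]
  rw [integral_fintype_prod_eq_prod (𝕜 := ℂ)
    (fun i (u : ℝ) => Complex.exp (ξ * ((u + v i) ^ 2 : ℝ) * Complex.I))]
  simp_rw [integral_cexp_sq_add_gaussianReal]
  rw [Finset.prod_mul_distrib, Finset.prod_const, Finset.card_univ, hκ, ← Complex.exp_sum,
    ← Finset.sum_div, ← Finset.mul_sum, ← Complex.ofReal_sum, ← hr, pow_mul, mul_pow]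
  congr 1
  -- The number of coordinates is even, so the principal square roots pair up and no choice of
  -- branch remains.
  rw [← Complex.cpow_nat_mul]
  have h1 : (√Real.pi : ℂ)⁻¹ ^ 2 = (Real.pi : ℂ)⁻¹ := by
    rw [inv_pow, ← Complex.ofReal_pow, Real.sq_sqrt Real.pi_pos.le]
  have hpi : (Real.pi : ℂ) ≠ 0 := Complex.ofReal_ne_zero.2 Real.pi_ne_zero
  rw [h1, Nat.cast_ofNat, mul_one_div_cancel two_ne_zero, Complex.cpow_one, div_mul_eq_mul_div,
    mul_inv_cancel₀ hpi, one_div, inv_pow]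

/-! ### The Marcum function as a Poisson mixture of Erlang tails, by the substitution `t = x ^ 2 /
2`. -/

lemma image_sq_div_two_Ioi {b : ℝ} (hb : 0 ≤ b) :
    (fun x : ℝ => x ^ 2 / 2) '' Set.Ioi b = Set.Ioi (b ^ 2 / 2) := by
  ext t
  simp only [Set.mem_image, Set.mem_Ioi]
  constructor
  · rintro ⟨x, hx, rfl⟩
    gcongr
  · intro ht
    refine ⟨√(2 * t), Real.lt_sqrt_of_sq_lt (by linarith), ?_⟩
    rw [Real.sq_sqrt (by nlinarith [sq_nonneg b])]
    ring

lemma injOn_sq_div_two_Ioi {b : ℝ} (hb : 0 ≤ b) :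
    Set.InjOn (fun x : ℝ => x ^ 2 / 2) (Set.Ioi b) := by
  intro x hx x' hx' h
  have hx : b < x := hx
  have hx' : b < x' := hx'
  have h : x ^ 2 / 2 = x' ^ 2 / 2 := h
  exact (pow_left_inj₀ (by linarith) (by linarith) two_ne_zero).1 (by linarith)

lemma hasDerivWithinAt_sq_div_two (b : ℝ) :
    ∀ x ∈ Set.Ioi b, HasDerivWithinAt (fun x : ℝ => x ^ 2 / 2) x (Set.Ioi b) x := fun x _ => by
  have h := ((hasDerivAt_pow 2 x).div_const 2).hasDerivWithinAt (s := Set.Ioi b)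
  convert! h using 1
  simp

lemma integrableOn_mul_erlangDensity_sq (k : ℕ) {b : ℝ} (hb : 0 ≤ b) :
    IntegrableOn (fun x => x * erlangDensity k (x ^ 2 / 2)) (Set.Ioi b) := by
  have h := (integrableOn_image_iff_integrableOn_abs_deriv_smul measurableSet_Ioi
    (hasDerivWithinAt_sq_div_two b) (injOn_sq_div_two_Ioi hb) (erlangDensity k)).1 (by
      rw [image_sq_div_two_Ioi hb]
      exact (integrableOn_erlangDensity k).mono_set (Set.Ioi_subset_Ioi (by positivity)))
  refine h.congr_fun (fun x hx => ?_) measurableSet_Ioi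
  simp [abs_of_pos (lt_of_le_of_lt hb hx)]

lemma integral_mul_erlangDensity_sq (k : ℕ) {b : ℝ} (hb : 0 ≤ b) :
    ∫ x in Set.Ioi b, x * erlangDensity k (x ^ 2 / 2) = (erlang k).real (Set.Ioi (b ^ 2 / 2)) := by
  rw [measureReal_erlang_Ioi k (by positivity), ← image_sq_div_two_Ioi hb,
    integral_image_eq_integral_abs_deriv_smul measurableSet_Ioi
    (hasDerivWithinAt_sq_div_two b) (injOn_sq_div_two_Ioi hb)]
  refine setIntegral_congr_fun measurableSet_Ioi fun x hx => ?_
  simp [abs_of_pos (lt_of_le_of_lt hb hx)]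

/-- Each Bessel term splits into a Poisson weight of mean `a ^ 2 / 2` and an Erlang density in `x ^
2 / 2` with its Jacobian `x`. At `a = 0` only `k = 0` survives, which is the separate branch of the
definition. -/
lemma marcumQ_eq_integral_tsum (n : ℕ) (a b : ℝ) :
    marcumQ (n + 1) a b = ∫ x in Set.Ioi b, ∑' k : ℕ,
      (Real.exp (-(a ^ 2 / 2)) * (a ^ 2 / 2) ^ k / k !) * (x * erlangDensity (n + k) (x ^ 2 / 2)) := by
  unfold marcumQ
  split_ifs with ha
  · subst ha
    rw [← integral_div]
    congr with x
    rw [tsum_eq_single 0 (fun k hk => by simp [hk])]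
    simp only [erlangDensity, Nat.add_sub_cancel, show 2 * (n + 1) - 1 = 2 * n + 1 by omega]
    simp
    rw [div_pow, ← pow_mul, neg_div]
    field_simp
    ring
  · rw [← integral_div]
    congr with x
    rw [besselI, ← tsum_mul_left, ← tsum_div_const]
    congr with k
    simp only [erlangDensity, Nat.add_sub_cancel]
    rw [show -(x ^ 2 + a ^ 2) / 2 = -(a ^ 2 / 2) + -(x ^ 2 / 2) by ring, Real.exp_add,
      add_comm k n]
    field_simp
    ring

lemma marcumQ_eq_integral_poissonMeasure (n : ℕ) (a : ℝ) {b : ℝ} (hb : 0 ≤ b) :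
    marcumQ (n + 1) a b = ∫ k, (erlang (n + k)).real (Set.Ioi (b ^ 2 / 2))
      ∂poissonMeasure (a ^ 2 / 2).toNNReal := by
  have hr : (((a ^ 2 / 2).toNNReal : ℝ≥0) : ℝ) = a ^ 2 / 2 := Real.coe_toNNReal _ (by positivity)
  have hs := hasSum_integral_poissonMeasure
    (integrable_measureReal_erlang n (a ^ 2 / 2).toNNReal (Set.Ioi (b ^ 2 / 2)))
  simp_rw [hr, smul_eq_mul] at hs
  rw [marcumQ_eq_integral_tsum, ← hs.tsum_eq]
  -- All terms are nonnegative on `Set.Ioi b`, so summability of the Poisson average justifies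
  -- exchanging sum and integral.
  have h := hasSum_integral_of_summable_integral_norm (μ := volume.restrict (Set.Ioi b))
    (F := fun (k : ℕ) x => (Real.exp (-(a ^ 2 / 2)) * (a ^ 2 / 2) ^ k / k !) *
      (x * erlangDensity (n + k) (x ^ 2 / 2)))
    (fun k => (integrableOn_mul_erlangDensity_sq (n + k) hb).const_mul _) ?_
  · rw [← h.tsum_eq]
    simp_rw [integral_const_mul, integral_mul_erlangDensity_sq _ hb]
  · convert! hs.summable using 2 with k
    rw [← integral_mul_erlangDensity_sq _ hb, ← integral_const_mul]
    refine setIntegral_congr_fun measurableSet_Ioi fun x hx => ?_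
    have hx : 0 ≤ x := hb.trans (le_of_lt hx)
    have := erlangDensity_nonneg (n + k) (t := x ^ 2 / 2) (by positivity)
    exact Real.norm_of_nonneg (by positivity)

lemma one_sub_marcumQ (n : ℕ) (a : ℝ) {b : ℝ} (hb : 0 ≤ b) :
    1 - marcumQ (n + 1) a b =
      (noncentralGamma n (a ^ 2 / 2).toNNReal).real (Set.Iio (b ^ 2 / 2)) := by
  rw [measureReal_noncentralGamma n _ measurableSet_Iio,
    marcumQ_eq_integral_poissonMeasure n a hb]
  simp_rw [measureReal_erlang_Iio_eq_one_sub]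
  rw [integral_sub (integrable_const _) (integrable_measureReal_erlang n _ _)]
  simp

/-! ### Reduction of the channel model to a product Gaussian measure. -/

lemma map_curry_pi {ι κ : Type*} [Fintype ι] [Fintype κ] {X : Type*} [MeasurableSpace X]
    (ν : Measure X) [IsProbabilityMeasure ν] :
    (Measure.pi fun _ : ι × κ => ν).map (MeasurableEquiv.curry ι κ X) =
      Measure.pi fun _ : ι => Measure.pi fun _ : κ => ν := by
  have h := Measure.infinitePi_map_curry (fun (_ : ι) (_ : κ) => ν)
  simpa only [Measure.infinitePi_eq_pi] using h

/-- The variables that drive the ports, with real and imaginary parts combined. -/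
def drive {Ω : Type*} {M N : ℕ} (x y : Fin M → Fin N → Ω → ℝ) (ω : Ω) (m : Fin M) :
    Fin N ⊕ Fin N → ℝ :=
  Sum.elim (fun n => x m n ω) (fun n => y m n ω)

lemma IsDrivingNoise.hasLaw_drive {Ω : Type*} [MeasurableSpace Ω] {μ : Measure Ω} {M N : ℕ}
    {x y : Fin M → Fin N → Ω → ℝ} (h : IsDrivingNoise μ x y) :
    HasLaw (drive x y)
      (Measure.pi fun _ : Fin M => Measure.pi fun _ : Fin N ⊕ Fin N => gaussianReal 0 (1 / 2)) μ := by
  have hlaw : HasLaw (fun ω (p : Fin M × (Fin N ⊕ Fin N)) => drive x y ω p.1 p.2)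
      (Measure.pi fun _ => gaussianReal 0 (1 / 2)) μ := by
    refine iIndepFun.hasLaw_pi (X := fun (p : Fin M × (Fin N ⊕ Fin N)) ω => drive x y ω p.1 p.2)
      ?_ ?_
    · rintro ⟨m, n | n⟩
      · exact h.law_x m n
      · exact h.law_y m n
    · have hi := h.indep.precomp (Equiv.prodSumDistrib (Fin M) (Fin N) (Fin N)).injective
      convert! hi using 1
      ext ⟨m, n | n⟩ ω <;> rfl
  have hcurry := (MeasurableEquiv.curry (Fin M) (Fin N ⊕ Fin N) ℝ).measurable
  refine ⟨hcurry.comp_aemeasurable hlaw.aemeasurable, ?_⟩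
  rw [← map_curry_pi, ← hlaw.map_eq, AEMeasurable.map_map_of_aemeasurable hcurry.aemeasurable
    hlaw.aemeasurable]
  rfl

/-- The precoding gain of port `m` for `σ = 1` as a function of the driving variables. -/
noncomputable def normalizedGain {M : ℕ} [NeZero M] {κ : Type*} [Fintype κ] (ρ : ℝ) (m : Fin M)
    (u : Fin M → κ → ℝ) : ℝ :=
  if m = 0 then ∑ i, u 0 i ^ 2 else ∑ i, (√(1 - ρ ^ 2) * u m i + ρ * u 0 i) ^ 2

lemma norm_sq_ofReal_add_I_mul (a b : ℝ) : ‖(a : ℂ) + Complex.I * (b : ℂ)‖ ^ 2 = a ^ 2 + b ^ 2 := by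
  rw [mul_comm, ← Complex.normSq_eq_norm_sq, Complex.normSq_add_mul_I]

lemma gain_eq {Ω : Type*} {M N : ℕ} [NeZero M] (σ ρ : ℝ) (x y : Fin M → Fin N → Ω → ℝ)
    (m : Fin M) (ω : Ω) : gain σ ρ x y m ω = σ ^ 2 * normalizedGain ρ m (drive x y ω) := by
  unfold gain normalizedGain
  split_ifs with h
  · rw [Fintype.sum_sum_type, ← Finset.sum_add_distrib, Finset.mul_sum]
    refine Finset.sum_congr rfl fun n _ => ?_
    rw [channel, if_pos h, norm_sq_ofReal_add_I_mul]
    simp only [drive, Sum.elim_inl, Sum.elim_inr]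
    ring
  · rw [Fintype.sum_sum_type, ← Finset.sum_add_distrib, Finset.mul_sum]
    refine Finset.sum_congr rfl fun n _ => ?_
    rw [channel, if_neg h, norm_sq_ofReal_add_I_mul]
    simp only [drive, Sum.elim_inl, Sum.elim_inr]
    ring

lemma gain_nonneg {Ω : Type*} {M N : ℕ} [NeZero M] (σ ρ : ℝ) (x y : Fin M → Fin N → Ω → ℝ)
    (m : Fin M) (ω : Ω) : 0 ≤ gain σ ρ x y m ω :=
  Finset.sum_nonneg fun _ _ => by positivity

lemma snr_eq {Ω : Type*} {M N : ℕ} [NeZero M] (P η₀ σ ρ : ℝ) (x y : Fin M → Fin N → Ω → ℝ)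
    (m : Fin M) (ω : Ω) : snr P η₀ σ ρ x y m ω = P * gain σ ρ x y m ω / η₀ ^ 2 := by
  have h : ∑ n, precoder σ ρ x y m ω n * channel σ ρ x y m n ω = ((√(gain σ ρ x y m ω) : ℝ) : ℂ) := by
    have h1 : ∀ n, precoder σ ρ x y m ω n * channel σ ρ x y m n ω =
        ((‖channel σ ρ x y m n ω‖ ^ 2 / √(gain σ ρ x y m ω) : ℝ) : ℂ) := fun n => by
      rw [precoder, div_mul_eq_mul_div, Complex.ofReal_div]
      congr 1
      rw [← Complex.normSq_eq_norm_sq]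
      exact (Complex.normSq_eq_conj_mul_self).symm
    simp_rw [h1]
    rw [← Complex.ofReal_sum, ← Finset.sum_div]
    -- The identity `x / √x = √x` also covers a vanishing channel, where both sides are zero.
    exact congrArg _ Real.div_sqrt
  rw [snr, h, Complex.norm_real, Real.norm_of_nonneg (Real.sqrt_nonneg _),
    Real.sq_sqrt (gain_nonneg σ ρ x y m ω)]

/-! ### Conditioning on the common component. -/

lemma measure_sum_sq_lt {κ : Type*} [Fintype κ] {n : ℕ} (hκ : Fintype.card κ = 2 * (n + 1))
    {s : ℝ} (hs : 0 < s) (ρ t : ℝ) (a : κ → ℝ) :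
    (Measure.pi fun _ : κ => gaussianReal 0 (1 / 2)) {b | ∑ i, (s * b i + ρ * a i) ^ 2 < t} =
      noncentralGamma n (ρ ^ 2 * (∑ i, a i ^ 2) / s ^ 2).toNNReal (Set.Iio (t / s ^ 2)) := by
  rw [← map_sum_sq_add_gaussianReal hκ (fun i => ρ * a i / s),
    Measure.map_apply (by fun_prop) measurableSet_Iio]
  · congr 1
    ext b
    simp only [Set.mem_ofPred_eq, Set.mem_preimage, Set.mem_Iio]
    rw [lt_div_iff₀ (by positivity), Finset.sum_mul]
    refine iff_of_eq (congrArg (· < t) (Finset.sum_congr rfl fun i _ => ?_))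
    field_simp
  · rw [Real.coe_toNNReal _ (by positivity), Finset.mul_sum, Finset.sum_div]
    refine Finset.sum_congr rfl fun i _ => ?_
    rw [div_pow, mul_pow]

lemma le_measure_normalizedGain_lt {κ : Type*} [Fintype κ] {n : ℕ}
    (hκ : Fintype.card κ = 2 * (n + 1)) (k : ℕ) {ρ : ℝ} (hρ : |ρ| < 1) (t : ℝ) :
    noncentralGamma n (ρ ^ 2 * t / (1 - ρ ^ 2)).toNNReal (Set.Iio (t / (1 - ρ ^ 2))) ^ k *
        erlang n (Set.Iio t) ≤
      (Measure.pi fun _ : Fin (k + 1) => Measure.pi fun _ : κ => gaussianReal 0 (1 / 2))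
        {u | ∀ m, normalizedGain ρ m u < t} := by
  set ν : Measure (κ → ℝ) := Measure.pi fun _ : κ => gaussianReal 0 (1 / 2) with hν
  have hρ2 : 0 < 1 - ρ ^ 2 := by
    have := (sq_lt_one_iff_abs_lt_one ρ).2 hρ
    linarith
  have hs : 0 < √(1 - ρ ^ 2) := Real.sqrt_pos.2 hρ2
  have hs2 : √(1 - ρ ^ 2) ^ 2 = 1 - ρ ^ 2 := Real.sq_sqrt hρ2.le
  set c := noncentralGamma n (ρ ^ 2 * t / (1 - ρ ^ 2)).toNNReal (Set.Iio (t / (1 - ρ ^ 2)))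
  let T : Set ((κ → ℝ) × (Fin k → κ → ℝ)) :=
    {p | ∑ i, p.1 i ^ 2 < t ∧ ∀ j, ∑ i, (√(1 - ρ ^ 2) * p.2 j i + ρ * p.1 i) ^ 2 < t}
  have hT : MeasurableSet T := by
    have : T = {p | ∑ i, p.1 i ^ 2 < t} ∩
        ⋂ j, {p | ∑ i, (√(1 - ρ ^ 2) * p.2 j i + ρ * p.1 i) ^ 2 < t} := by
      ext p; simp [T]
    rw [this]
    exact (measurableSet_lt (by fun_prop) measurable_const).inter
      (MeasurableSet.iInter fun j => measurableSet_lt (by fun_prop) measurable_const)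
  have hpre : {u : Fin (k + 1) → κ → ℝ | ∀ m, normalizedGain ρ m u < t} =
      MeasurableEquiv.piFinSuccAbove (fun _ => κ → ℝ) 0 ⁻¹' T := by
    ext u
    simp only [Set.mem_ofPred_eq, Set.mem_preimage, T, Fin.forall_fin_succ, normalizedGain,
      Fin.succ_ne_zero, if_true, if_false]
    rfl
  have hmp := measurePreserving_piFinSuccAbove (fun _ : Fin (k + 1) => ν) 0
  rw [hpre, hmp.measure_preimage hT.nullMeasurableSet, Measure.prod_apply hT]
  set A : Set (κ → ℝ) := {a | ∑ i, a i ^ 2 < t}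
  have hA : MeasurableSet A := measurableSet_lt (by fun_prop) measurable_const
  have hνA : ν A = erlang n (Set.Iio t) := by
    -- Port `0` is the case of unit scale and no shift, where the mixture reduces to a single Erlang
    -- law.
    have h := measure_sum_sq_lt hκ one_pos 0 t (0 : κ → ℝ)
    simp only [one_mul, zero_mul, add_zero, one_pow, div_one] at h
    refine h.trans ?_
    rw [← measureReal_eq_measureReal_iff]
    simpa using measureReal_noncentralGamma_zero_Iio n t
  calc c ^ k * erlang n (Set.Iio t) = ∫⁻ _ in A, c ^ k ∂ν := by rw [setLIntegral_const, hνA]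
    _ ≤ ∫⁻ a in A, (Measure.pi fun _ : Fin k => ν) (Prod.mk a ⁻¹' T) ∂ν := by
        refine setLIntegral_mono' hA fun a ha => ?_
        -- For fixed `a` in `A`, the fibre is a box, so its measure is a product over the remaining
        -- `k` ports.
        have hpi : Prod.mk a ⁻¹' T = Set.univ.pi fun _ : Fin k =>
            {b : κ → ℝ | ∑ i, (√(1 - ρ ^ 2) * b i + ρ * a i) ^ 2 < t} := by
          ext b
          simp only [Set.mem_preimage, T, Set.mem_ofPred_eq, Set.mem_univ_pi]
          exact and_iff_right ha
        rw [hpi, Measure.pi_pi, Finset.prod_const, Finset.card_univ, Fintype.card_fin]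
        gcongr
        rw [hν, measure_sum_sq_lt hκ hs, hs2]
        refine (ENNReal.toReal_le_toReal (measure_ne_top _ _) (measure_ne_top _ _)).1 ?_
        refine measureReal_noncentralGamma_Iio_antitone n _ (Real.toNNReal_le_toNNReal ?_)
        have ha : ∑ i, a i ^ 2 < t := ha
        gcongr
    _ ≤ ∫⁻ a, (Measure.pi fun _ : Fin k => ν) (Prod.mk a ⁻¹' T) ∂ν := setLIntegral_le_lintegral _ _

lemma outageLowerBound_eq (n M : ℕ) {ρ t : ℝ} (hρ : |ρ| < 1) (ht : 0 ≤ t) :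
    outageLowerBound (n + 1) M ρ 1 t = (erlang n).real (Set.Iio t) *
      (noncentralGamma n (ρ ^ 2 * t / (1 - ρ ^ 2)).toNNReal).real
        (Set.Iio (t / (1 - ρ ^ 2))) ^ (M - 1) := by
  have hρ2 : 0 < 1 - ρ ^ 2 := by
    have := (sq_lt_one_iff_abs_lt_one ρ).2 hρ
    linarith
  have ha : 2 * ρ ^ 2 * t / (1 * (1 - ρ ^ 2)) / 2 = ρ ^ 2 * t / (1 - ρ ^ 2) := by ring
  have hb : 2 * t / (1 * (1 - ρ ^ 2)) / 2 = t / (1 - ρ ^ 2) := by ring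
  rw [outageLowerBound, one_sub_marcumQ n _ (Real.sqrt_nonneg _), Real.sq_sqrt (by positivity),
    Real.sq_sqrt (by positivity), measureReal_erlang_Iio_eq_lowerGamma n ht, Nat.add_sub_cancel,
    div_one, ha, hb]

/-- The bound depends on `g` and `s` only through `g / s`, so one normalized estimate serves all
three outage events. -/
lemma outageLowerBound_eq_div (N M : ℕ) (ρ s g : ℝ) :
    outageLowerBound N M ρ s g = outageLowerBound N M ρ 1 (g / s) := by
  simp only [outageLowerBound, div_one, one_mul]
  congr 4 <;> (congr 1; rw [mul_div_assoc', div_div])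

lemma IsDrivingNoise.outageLowerBound_le {Ω : Type*} [MeasurableSpace Ω] {μ : Measure Ω}
    [IsProbabilityMeasure μ] {M N : ℕ} [NeZero M] [NeZero N] {ρ : ℝ} (hρ : |ρ| < 1)
    {x y : Fin M → Fin N → Ω → ℝ} (h : IsDrivingNoise μ x y) {t : ℝ} (ht : 0 ≤ t) :
    outageLowerBound N M ρ 1 t ≤ μ.real {ω | ∀ m, normalizedGain ρ m (drive x y ω) < t} := by
  obtain ⟨n, rfl⟩ := Nat.exists_eq_succ_of_ne_zero (NeZero.ne N)
  obtain ⟨k, rfl⟩ := Nat.exists_eq_succ_of_ne_zero (NeZero.ne M)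
  have hmeas : MeasurableSet {u : Fin (k + 1) → Fin (n + 1) ⊕ Fin (n + 1) → ℝ |
      ∀ m, normalizedGain ρ m u < t} := by
    have hset : {u : Fin (k + 1) → Fin (n + 1) ⊕ Fin (n + 1) → ℝ |
        ∀ m, normalizedGain ρ m u < t} = ⋂ m, {u | normalizedGain ρ m u < t} := by
      ext u; simp
    refine hset ▸ MeasurableSet.iInter fun m => measurableSet_lt ?_ measurable_const
    unfold normalizedGain
    split_ifs <;> fun_prop
  have hcore := le_measure_normalizedGain_lt (κ := Fin (n + 1) ⊕ Fin (n + 1)) (n := n)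
    (by simp; ring) k hρ t
  rw [← h.hasLaw_drive.map_eq, Measure.map_apply_of_aemeasurable h.hasLaw_drive.aemeasurable
    hmeas] at hcore
  have hreal := ENNReal.toReal_mono (measure_ne_top _ _) hcore
  rw [ENNReal.toReal_mul, ENNReal.toReal_pow, mul_comm] at hreal
  exact (outageLowerBound_eq n _ hρ ht).trans_le hreal

end FAS

theorem corollary2 {Ω : Type*} [MeasurableSpace Ω] (μ : Measure Ω) [IsProbabilityMeasure μ]
    (M N : ℕ) [NeZero M] [NeZero N]
    (P η₀ σ ρ γth : ℝ) (hP : 0 < P) (hη₀ : 0 < η₀) (hσ : 0 < σ) (hρ : |ρ| < 1) (hγth : 0 < γth)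
    (x y : Fin M → Fin N → Ω → ℝ) (hxy : FAS.IsDrivingNoise μ x y) :
    -- the outage event of the precoding gain
    (μ.real {ω | FAS.gainFAS σ ρ x y ω < γth} ≥ FAS.outageLowerBound N M ρ (σ ^ 2) γth) ∧
    -- the outage event of the received SNR
    (μ.real {ω | FAS.snrFAS P η₀ σ ρ x y ω < γth} ≥
      FAS.outageLowerBound N M ρ (FAS.avgSNR P η₀ σ) γth) ∧
    -- the outage event of the received SNR normalized by its single-branch average
    (μ.real {ω | FAS.snrFAS P η₀ σ ρ x y ω / FAS.avgSNR P η₀ σ < γth} ≥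
      FAS.outageLowerBound N M ρ 1 γth) := by
  have havg : 0 < FAS.avgSNR P η₀ σ := by unfold FAS.avgSNR; positivity
  have hsnr : ∀ g, {ω | FAS.snrFAS P η₀ σ ρ x y ω < g} =
      {ω | ∀ m, FAS.normalizedGain ρ m (FAS.drive x y ω) < g / FAS.avgSNR P η₀ σ} := fun g => by
    ext ω
    simp only [Set.mem_ofPred_eq, FAS.snrFAS, Finset.sup'_lt_iff, Finset.mem_univ, true_imp_iff]
    refine forall_congr' fun m => ?_
    rw [FAS.snr_eq, FAS.gain_eq, lt_div_iff₀ havg, FAS.avgSNR]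
    refine iff_of_eq (congrArg (· < g) ?_)
    ring
  refine ⟨?_, ?_, ?_⟩
  · have hgain : {ω | FAS.gainFAS σ ρ x y ω < γth} =
        {ω | ∀ m, FAS.normalizedGain ρ m (FAS.drive x y ω) < γth / σ ^ 2} := by
      ext ω
      simp only [Set.mem_ofPred_eq, FAS.gainFAS, Finset.sup'_lt_iff, Finset.mem_univ, true_imp_iff]
      refine forall_congr' fun m => ?_
      rw [FAS.gain_eq, lt_div_iff₀ (by positivity), mul_comm]
    rw [hgain, FAS.outageLowerBound_eq_div]
    exact hxy.outageLowerBound_le hρ (by positivity)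
  · rw [hsnr, FAS.outageLowerBound_eq_div]
    exact hxy.outageLowerBound_le hρ (by positivity)
  · simp_rw [div_lt_iff₀ havg]
    rw [hsnr, mul_div_cancel_right₀ _ havg.ne']
    exact hxy.outageLowerBound_le hρ hγth.le
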